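/- For $A\subseteq\mathbb N$ and $n\ge 1$ let $\rho_n(A)=|A\cap\{0,\dots,n-1\}|/n$. The lower density of $A$ is $\underline\rho(A)=\liminf_n\rho_n(A)$, and $A$ has density $d$ if $\lim_n\rho_n(A)=d$. A set $A\subseteq\mathbb N$ is coarsely computable if there is a computable set $C$ such that $\{n: A(n)=C(n)\}$ has density $1$. For $r\in[0,1]$, $A$ is coarsely computable at density $r$ if there is a computable set $C$ with $\underline\rho(\{n:A(n)=C(n)\})\ge r$. The coarse computability bound of $A$ is $\gamma(A)=\sup\{r\in[0,1]: A\text{ is coarsely computable at density }r\}$. A set $G\subseteq\mathbb N$ is $1$-generic if for every c.e. set $S$ of finite binary strings, either some initial segment of $G$ belongs to $S$, or some initial segment of $G$ has no extension in $S$. Theorem. (1) Let $G$ be a $\Delta^0_2$ $1$-generic set, and suppose that $A\le_T G$ and $\gamma(A)=1$. Then $A$ is coarsely computable. (2) Not every nonzero Turing degree contains a set $A$ such that $\gamma(A)=1$ but $A$ is not coarsely computable. That is, there is a noncomputable set $B$ such that every set $A\equiv_T B$ with $\gamma(A)=1$ is coarsely computable. -/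

import Mathlib

namespace CoarseComp

open Filter Topology

/-- A computable set of natural numbers. -/
def ComputableSet (C : Set ℕ) : Prop := ComputablePred fun n => n ∈ C

open Classical in
/-- The characteristic function of `A`, as an oracle. -/
noncomputable def charFun (A : Set ℕ) : ℕ →. ℕ := fun n => Part.some (if n ∈ A then 1 else 0)

/-- Turing reducibility of sets. -/
def SetTuringLE (A B : Set ℕ) : Prop := TuringReducible (charFun A) (charFun B)

/-- Turing equivalence of sets: `A` and `B` have the same Turing degree. -/
def SetTuringEquiv (A B : Set ℕ) : Prop := SetTuringLE A B ∧ SetTuringLE B A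

/-- `A` is `Σ⁰₂`. -/
def IsSigma02 (A : Set ℕ) : Prop :=
  ∃ R : ℕ × ℕ × ℕ → Prop, ComputablePred R ∧ ∀ n, n ∈ A ↔ ∃ x, ∀ y, R (n, x, y)

/-- `A` is `Π⁰₂`. -/
def IsPi02 (A : Set ℕ) : Prop :=
  ∃ R : ℕ × ℕ × ℕ → Prop, ComputablePred R ∧ ∀ n, n ∈ A ↔ ∀ x, ∃ y, R (n, x, y)

/-- `A` is `Δ⁰₂`. -/
def IsDelta02 (A : Set ℕ) : Prop := IsSigma02 A ∧ IsPi02 A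

open Classical in
/-- The binary string `A(0) A(1) ⋯ A(n-1)`. -/
noncomputable def initSeg (A : Set ℕ) (n : ℕ) : List Bool :=
  (List.range n).map fun i => decide (i ∈ A)

/-- Some initial segment of `A` belongs to `S`. -/
def Meets (A : Set ℕ) (S : Set (List Bool)) : Prop := ∃ n, initSeg A n ∈ S

/-- Some initial segment of `A` has no extension in `S`. -/
def Avoids (A : Set ℕ) (S : Set (List Bool)) : Prop :=
  ∃ n, ∀ τ : List Bool, initSeg A n <+: τ → τ ∉ S

/-- `A` is 1-generic: it meets or avoids every c.e. set of binary strings. -/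
def IsOneGeneric (A : Set ℕ) : Prop :=
  ∀ S : Set (List Bool), REPred (fun σ => σ ∈ S) → Meets A S ∨ Avoids A S

/-- The density of `A` below `n`: `|A ∩ {0, …, n-1}| / n`. -/
noncomputable def densityBelow (A : Set ℕ) (n : ℕ) : ℝ := (A ∩ Set.Iio n).ncard / n

/-- The lower density of `A`. -/
noncomputable def lowerDensity (A : Set ℕ) : ℝ := liminf (densityBelow A) atTop

/-- `A` has asymptotic density `d`. -/
def HasDensity (A : Set ℕ) (d : ℝ) : Prop := Tendsto (densityBelow A) atTop (𝓝 d)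

/-- The set of arguments on which `A` and `B` agree. -/
def agreement (A B : Set ℕ) : Set ℕ := {n | n ∈ A ↔ n ∈ B}

/-- `A` is coarsely computable. -/
def CoarselyComputable (A : Set ℕ) : Prop :=
  ∃ C : Set ℕ, ComputableSet C ∧ HasDensity (agreement A C) 1

/-- `A` is coarsely computable at density `r`. -/
def CoarselyComputableAt (A : Set ℕ) (r : ℝ) : Prop :=
  ∃ C : Set ℕ, ComputableSet C ∧ r ≤ lowerDensity (agreement A C)

/-- The coarse computability bound `γ(A)`. -/
noncomputable def coarseBound (A : Set ℕ) : ℝ :=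
  sSup {r : ℝ | r ∈ Set.Icc (0 : ℝ) 1 ∧ CoarselyComputableAt A r}

end CoarseComp

/-! Let `P τ ρ` be the c.e. relation "the oracle string `τ` computes `ρ`"; along `G` it yields
exactly the initial segments of `A`. Fix `k`. As γ(A) = 1, some computable `C` differs from `A` on a
fraction at most 2^-(k+1) of every long initial segment. The strings computing something farther
from `C` form a c.e. set that `G` does not meet, so by genericity `G` avoids it. Past some initial
segment of `G`, all long outputs are therefore near `C`, and so within 2^-k of each other
(`exists_not_hasSplitting`); `C` itself is no longer needed.

Such an unsplit segment can be guessed in the limit: having a splitting is c.e. and `G` is Δ⁰₂. For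
each `j`, search for a stage `t ≥ j` and a string `τ` computing 2^(j+1) bits such that, for every `k
≤ j`, some prefix of `τ` agrees with the stage-`t` approximation to `G` and is not yet seen to
split. For fixed `k` and large `j`, all segments of `G` shorter than the least unsplit one have been
refuted, so `τ` extends that one and its output is within 2^-k of `A`. Patching the outputs on
dyadic blocks gives a coarse description (`hasDensity_of_blocks`).

For (2), a finite-extension construction guessed in the limit gives a Δ⁰₂ 1-generic set; it is not
computable, and (1) applies to every set in its degree. -/

section Computability

/-! ### Closure properties of computable and c.e. predicates -/

variable {α β : Type*} [Primcodable α] [Primcodable β]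

theorem ComputablePred.comp {p : β → Prop} {f : α → β} (hp : ComputablePred p)
    (hf : Computable f) : ComputablePred fun a => p (f a) := by
  classical exact (hp.decide.comp hf).computablePred

theorem ComputablePred.and {p q : α → Prop} (hp : ComputablePred p) (hq : ComputablePred q) :
    ComputablePred fun a => p a ∧ q a := by
  classical
  exact ((Primrec.and.to_comp.comp hp.decide hq.decide).of_eq fun a => by simp).computablePred

theorem ComputablePred.or {p q : α → Prop} (hp : ComputablePred p) (hq : ComputablePred q) :
    ComputablePred fun a => p a ∨ q a := by
  classical
  exact ((Primrec.or.to_comp.comp hp.decide hq.decide).of_eq fun a => by simp).computablePred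

/-- Computable predicates are closed under bounded universal quantification. -/
theorem ComputablePred.forall_lt {p : α → ℕ → Prop} {b : α → ℕ}
    (hp : ComputablePred fun x : α × ℕ => p x.1 x.2) (hb : Computable b) :
    ComputablePred fun a => ∀ i < b a, p a i := by
  classical
  have h : Computable fun a => Nat.rec (motive := fun _ => Bool) true
      (fun i r => r && decide (p a i)) (b a) :=
    Computable.nat_rec hb (Computable.const true)
      (Primrec.and.to_comp.comp (Computable.snd.comp Computable.snd)
        (hp.decide.comp (Computable.fst.pair (Computable.fst.comp Computable.snd)))).to₂
  refine (h.of_eq fun a => ?_).computablePred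
  induction b a with
  | zero => simp
  | succ n ih => simp only [ih, Nat.forall_lt_succ_right, Bool.decide_and]

/-- Computable predicates are closed under bounded existential quantification. -/
theorem ComputablePred.exists_lt {p : α → ℕ → Prop} {b : α → ℕ}
    (hp : ComputablePred fun x : α × ℕ => p x.1 x.2) (hb : Computable b) :
    ComputablePred fun a => ∃ i < b a, p a i :=
  (ComputablePred.forall_lt (p := fun a i => ¬ p a i) hp.not hb).not.of_eq fun a => by simp

theorem Computable.computablePred_eq {f g : α → β} (hf : Computable f) (hg : Computable g) :
    ComputablePred fun a => f a = g a :=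
  ComputablePred.comp (p := fun x : β × β => x.1 = x.2)
    (PrimrecPred.computablePred Primrec.eq) (hf.pair hg)

theorem Computable.computablePred_le {f g : α → ℕ} (hf : Computable f) (hg : Computable g) :
    ComputablePred fun a => f a ≤ g a :=
  ComputablePred.comp (p := fun x : ℕ × ℕ => x.1 ≤ x.2)
    (PrimrecPred.computablePred Primrec.nat_le) (hf.pair hg)

theorem Computable.computablePred_lt {f g : α → ℕ} (hf : Computable f) (hg : Computable g) :
    ComputablePred fun a => f a < g a :=
  ComputablePred.comp (p := fun x : ℕ × ℕ => x.1 < x.2)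
    (PrimrecPred.computablePred Primrec.nat_lt) (hf.pair hg)

theorem Computable.computablePred_isPrefix {f g : α → List β}
    (hf : Computable f) (hg : Computable g) : ComputablePred fun a => f a <+: g a :=
  (hf.computablePred_eq (Primrec.list_take.to_comp.comp (Computable.list_length.comp hf) hg)).of_eq
    fun _ => List.prefix_iff_eq_take.symm

theorem Computable.two_pow {f : α → ℕ} (hf : Computable f) : Computable fun a => 2 ^ f a :=
  (Primrec₂.unpaired'.1 Nat.Primrec.pow).to_comp.comp (Computable.const 2) hf

theorem Computable.log_two : Computable (Nat.log 2) := by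
  have hex : ∀ n, ∃ j, n < 2 ^ (j + 1) := fun n =>
    ⟨n, Nat.lt_two_pow_self.trans (Nat.pow_lt_pow_succ one_lt_two)⟩
  refine (Computable.find (P := fun n j => n < 2 ^ (j + 1))
    (Computable.fst.computablePred_lt (Computable.succ.comp Computable.snd).two_pow) hex).of_eq
    fun n => ?_
  rw [Nat.find_eq_iff]
  refine ⟨Nat.lt_pow_succ_log_self one_lt_two n, fun m hm h => ?_⟩
  have := Nat.log_lt_of_lt_pow' (by omega) h
  omega

/-- A recursively enumerable predicate is the projection of a computable one. -/
theorem REPred.exists_computablePred {p : α → Prop} (hp : REPred p) :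
    ∃ B : α × ℕ → Prop, ComputablePred B ∧ ∀ a, p a ↔ ∃ c, B (a, c) := by
  obtain ⟨c, hc⟩ := Nat.Partrec.Code.exists_code.1 hp
  refine ⟨fun x => (Nat.Partrec.Code.evaln x.2 c (Encodable.encode x.1)).isSome = true, ?_, ?_⟩
  · exact Computable.computablePred_eq (Primrec.option_isSome.to_comp.comp
      (Nat.Partrec.Code.primrec_evaln.to_comp.comp
        ((Computable.snd.pair (Computable.const c)).pair
          (Computable.encode.comp Computable.fst)))) (Computable.const true)
  · intro a
    have h : p a ↔ (Nat.Partrec.Code.eval c (Encodable.encode a)).Dom := by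
      rw [hc]; simp [Part.assert, Part.some, Part.bind]
    rw [h, Part.dom_iff_mem]
    simp only [Nat.Partrec.Code.evaln_complete, Option.isSome_iff_exists, Option.mem_def]
    exact exists_comm

/-- Uniformization of recursively enumerable relations, at the level of partial functions. -/
theorem REPred.exists_partrec_selector {R : α → β → Prop}
    (hR : REPred fun x : α × β => R x.1 x.2) :
    ∃ f : α →. β, Partrec f ∧ (∀ a, ∀ b ∈ f a, R a b) ∧ ∀ a, (f a).Dom ↔ ∃ b, R a b := by
  classical
  obtain ⟨B, hB, hRB⟩ := hR.exists_computablePred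
  -- `m` codes a candidate `b` together with a certificate for `R a b`.
  let g : α → ℕ → Option β := fun a m =>
    (Encodable.decode (α := β) m.unpair.1).bind fun b =>
      bif decide (B ((a, b), m.unpair.2)) then some b else none
  have hg : Computable₂ g := by
    refine Computable.option_bind (Computable.decode.comp
      (Computable.fst.comp (Computable.unpair.comp Computable.snd))) ?_
    refine Computable.cond (hB.decide.comp ?_) (Computable.option_some.comp Computable.snd)
      (Computable.const none)
    exact ((Computable.fst.comp Computable.fst).pair Computable.snd).pair
      (Computable.snd.comp (Computable.unpair.comp (Computable.snd.comp Computable.fst)))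
  have hmem : ∀ a m b, b ∈ g a m ↔
      Encodable.decode (α := β) m.unpair.1 = some b ∧ B ((a, b), m.unpair.2) := by
    intro a m b
    simp only [g, Option.mem_def, Option.bind_eq_some_iff, Bool.cond_decide]
    constructor
    · rintro ⟨b', h, h'⟩
      split_ifs at h' with hh
      cases h'
      exact ⟨h, hh⟩
    · rintro ⟨h, h'⟩
      exact ⟨b, h, by simp [h']⟩
  refine ⟨fun a => Nat.rfindOpt (g a), Partrec.rfindOpt hg, fun a b hb => ?_, fun a => ?_⟩
  · obtain ⟨m, hm⟩ := Nat.rfindOpt_spec hb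
    exact (hRB (a, b)).2 ⟨_, ((hmem _ _ _).1 hm).2⟩
  · rw [Nat.rfindOpt_dom]
    constructor
    · rintro ⟨m, b, hm⟩
      exact ⟨b, (hRB (a, b)).2 ⟨_, ((hmem _ _ _).1 hm).2⟩⟩
    · rintro ⟨b, hb⟩
      obtain ⟨c, hc⟩ := (hRB (a, b)).1 hb
      exact ⟨Nat.pair (Encodable.encode b) c, b, (hmem _ _ _).2 (by simpa using hc)⟩

/-- Uniformization of total recursively enumerable relations. -/
theorem REPred.exists_computable_selector {R : α → β → Prop}
    (hR : REPred fun x : α × β => R x.1 x.2) (htot : ∀ a, ∃ b, R a b) :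
    ∃ f : α → β, Computable f ∧ ∀ a, R a (f a) := by
  obtain ⟨f, hf, hfR, hdom⟩ := hR.exists_partrec_selector
  have hd : ∀ a, (f a).Dom := fun a => (hdom a).2 (htot a)
  exact ⟨fun a => (f a).get (hd a), hf.of_eq_tot fun a => Part.get_mem _,
    fun a => hfR a _ (Part.get_mem _)⟩

theorem REPred.exists {R : α → β → Prop} (hR : REPred fun x : α × β => R x.1 x.2) :
    REPred fun a => ∃ b, R a b := by
  obtain ⟨f, hf, -, hdom⟩ := hR.exists_partrec_selector
  exact hf.dom_re.of_eq hdom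

theorem REPred.comp {p : β → Prop} {f : α → β} (hp : REPred p) (hf : Computable f) :
    REPred fun a => p (f a) :=
  Partrec.comp hp hf

theorem REPred.and {p q : α → Prop} (hp : REPred p) (hq : REPred q) :
    REPred fun a => p a ∧ q a := by
  obtain ⟨B, hB, hpB⟩ := hp.exists_computablePred
  obtain ⟨B', hB', hqB⟩ := hq.exists_computablePred
  have h : REPred fun x : α × (ℕ × ℕ) => B (x.1, x.2.1) ∧ B' (x.1, x.2.2) :=
    ((hB.comp (Computable.fst.pair (Computable.fst.comp Computable.snd))).and
      (hB'.comp (Computable.fst.pair (Computable.snd.comp Computable.snd)))).to_re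
  refine (REPred.exists (R := fun a (c : ℕ × ℕ) => B (a, c.1) ∧ B' (a, c.2)) h).of_eq fun a => ?_
  rw [hpB, hqB]
  simp

/-- Recursively enumerable predicates are closed under bounded universal quantification. -/
theorem REPred.forall_lt {p : α → ℕ → Prop} {b : α → ℕ}
    (hp : REPred fun x : α × ℕ => p x.1 x.2) (hb : Computable b) :
    REPred fun a => ∀ i < b a, p a i := by
  obtain ⟨B, hB, hpB⟩ := hp.exists_computablePred
  -- One number bounds the finitely many certificates, turning ∀∃ into ∃ over a decidable matrix.
  have h : ComputablePred fun x : α × ℕ => ∀ i < b x.1, ∃ c < x.2, B ((x.1, i), c) := by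
    refine ComputablePred.forall_lt (p := fun (x : α × ℕ) i => ∃ c < x.2, B ((x.1, i), c)) ?_
      (hb.comp Computable.fst)
    refine ComputablePred.exists_lt
      (p := fun (y : (α × ℕ) × ℕ) c => B ((y.1.1, y.2), c)) ?_
      (Computable.snd.comp Computable.fst)
    exact hB.comp (((Computable.fst.comp (Computable.fst.comp Computable.fst)).pair
      (Computable.snd.comp Computable.fst)).pair Computable.snd)
  refine (REPred.exists (R := fun a M => ∀ i < b a, ∃ c < M, B ((a, i), c)) h.to_re).of_eq
    fun a => ⟨fun ⟨M, hM⟩ i hi => ?_, fun H => ?_⟩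
  · obtain ⟨c, -, hc⟩ := hM i hi
    exact (hpB (a, i)).2 ⟨c, hc⟩
  · choose! c hc using fun i hi => (hpB (a, i)).1 (H i hi)
    refine ⟨(Finset.range (b a)).sup c + 1, fun i hi => ⟨c i, ?_, hc i hi⟩⟩
    exact Nat.lt_succ_of_le (Finset.le_sup (f := c) (Finset.mem_range.2 hi))

/-- The graph of a partial recursive function is recursively enumerable. -/
theorem Partrec.rePred_mem {f : α →. β} (hf : Partrec f) :
    REPred fun x : α × β => x.2 ∈ f x.1 := by
  classical
  have h : Partrec fun x : α × β => (f x.1).bind fun b => ((bif decide (b = x.2) then some () else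
      Option.none : Option Unit) : Part Unit) := by
    refine (hf.comp Computable.fst).bind (Computable.ofOption ?_)
    exact Computable.cond (Computable.snd.computablePred_eq
      (Computable.snd.comp Computable.fst)).decide (Computable.const _) (Computable.const _)
  refine h.dom_re.of_eq fun x => ?_
  rw [Part.dom_iff_mem]
  simp only [Part.mem_bind_iff, Part.mem_coe, Bool.cond_decide]
  constructor
  · rintro ⟨_, b, hb, h'⟩
    split_ifs at h' with hh
    · exact hh ▸ hb
    · simp at h'
  · intro hx
    exact ⟨(), _, hx, by simp⟩

end Computability

/-! ### Oracle computations as monotone functionals on strings -/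

namespace CoarseComp

open Filter Topology

@[simp]
theorem length_initSeg (A : Set ℕ) (n : ℕ) : (initSeg A n).length = n := by
  simp [initSeg]

open Classical in
theorem getElem?_initSeg {A : Set ℕ} {n i : ℕ} (h : i < n) :
    (initSeg A n)[i]? = some (decide (i ∈ A)) := by
  simp [initSeg, h]

theorem take_initSeg (A : Set ℕ) {m n : ℕ} (h : m ≤ n) : (initSeg A n).take m = initSeg A m := by
  simp [initSeg, ← List.map_take, List.take_range, h]

theorem initSeg_isPrefix (A : Set ℕ) {m n : ℕ} (h : m ≤ n) : initSeg A m <+: initSeg A n := by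
  rw [← take_initSeg A h]
  exact List.take_prefix _ _

open Classical in
theorem eq_initSeg {A : Set ℕ} {σ : List Bool} {n : ℕ} (hn : σ.length = n)
    (h : ∀ i < n, σ[i]? = some (decide (i ∈ A))) : σ = initSeg A n := by
  apply List.ext_getElem?
  intro i
  by_cases hi : i < n
  · rw [h i hi, getElem?_initSeg hi]
  · rw [List.getElem?_eq_none (by omega), List.getElem?_eq_none (by simp; omega)]

/-- `F` is a partial recursive functional, given by its values on finite oracles, that sends the
oracle `G` to `f`. -/
structure Computes (F : List Bool → ℕ →. ℕ) (G : Set ℕ) (f : ℕ →. ℕ) : Prop where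
  partrec : Partrec₂ F
  mono : ∀ {σ τ : List Bool}, σ <+: τ → ∀ {n v}, v ∈ F σ n → v ∈ F τ n
  mem_iff : ∀ {n v}, v ∈ f n ↔ ∃ l, v ∈ F (initSeg G l) n

theorem Computes.mono_initSeg {F : List Bool → ℕ →. ℕ} {G : Set ℕ} {f : ℕ →. ℕ}
    (h : Computes F G f) {l m n v : ℕ} (hlm : l ≤ m) (hv : v ∈ F (initSeg G l) n) :
    v ∈ F (initSeg G m) n :=
  h.mono (initSeg_isPrefix G hlm) hv

/-- A functional that ignores its oracle. -/
theorem Computes.of_partrec {f : ℕ →. ℕ} (hf : Nat.Partrec f) (G : Set ℕ) :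
    Computes (fun _ => f) G f where
  partrec := (Partrec.nat_iff.2 hf).comp Computable.snd
  mono _ _ _ h := h
  mem_iff := by simp

/-- Queries beyond the length of `σ` diverge rather than receive a default answer; this is what
makes the functional monotone. -/
theorem Computes.oracle (G : Set ℕ) :
    Computes (fun σ n => ((σ[n]?.map Bool.toNat : Option ℕ) : Part ℕ)) G (charFun G) where
  partrec := Computable.ofOption (Computable.option_map Computable.list_getElem?
    ((Primrec.dom_bool Bool.toNat).to_comp.comp Computable.snd))
  mono := by
    rintro σ τ ⟨ρ, rfl⟩ n v h
    simp only [Part.mem_coe, Option.mem_def, Option.map_eq_some_iff] at h ⊢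
    obtain ⟨b, hb, rfl⟩ := h
    obtain ⟨hn, -⟩ := List.getElem?_eq_some_iff.1 hb
    exact ⟨b, by rw [List.getElem?_append_left hn, hb], rfl⟩
  mem_iff := by
    intro n v
    have hval : ∀ l, n < l → ((initSeg G l)[n]?.map Bool.toNat = some v ↔ v ∈ charFun G n) := by
      intro l hl
      rw [getElem?_initSeg hl]
      by_cases hG : n ∈ G <;> simp [charFun, hG, eq_comm]
    simp only [Part.mem_coe, Option.mem_def]
    refine ⟨fun h => ⟨n + 1, (hval _ n.lt_succ_self).2 h⟩, fun ⟨l, h⟩ => (hval l ?_).1 h⟩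
    by_contra hl
    rw [List.getElem?_eq_none (by simpa using hl)] at h
    simp at h

theorem Computes.pair {F H : List Bool → ℕ →. ℕ} {G : Set ℕ} {f h : ℕ →. ℕ}
    (hF : Computes F G f) (hH : Computes H G h) :
    Computes (fun σ n => (F σ n).bind fun a => (H σ n).map (Nat.pair a)) G
      (fun n => Nat.pair <$> f n <*> h n) where
  partrec := by
    refine hF.partrec.bind ?_
    refine (hH.partrec.comp (Computable.fst.comp Computable.fst)
      (Computable.snd.comp Computable.fst)).map ?_
    exact Primrec₂.natPair.to_comp.comp (Computable.snd.comp Computable.fst) Computable.snd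
  mono := by
    intro σ τ hστ n v
    simp only [Part.mem_bind_iff, Part.mem_map_iff]
    rintro ⟨a, ha, b, hb, rfl⟩
    exact ⟨a, hF.mono hστ ha, b, hH.mono hστ hb, rfl⟩
  mem_iff := by
    intro n v
    simp only [Seq.seq, Part.map_eq_map, Part.mem_bind_iff, Part.mem_map_iff, Part.bind_map]
    constructor
    · rintro ⟨a, ha, b, hb, rfl⟩
      obtain ⟨l, hl⟩ := hF.mem_iff.1 ha
      obtain ⟨m, hm⟩ := hH.mem_iff.1 hb
      exact ⟨max l m, a, hF.mono_initSeg (le_max_left _ _) hl, b,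
        hH.mono_initSeg (le_max_right _ _) hm, rfl⟩
    · rintro ⟨l, a, ha, b, hb, rfl⟩
      exact ⟨a, hF.mem_iff.2 ⟨l, ha⟩, b, hH.mem_iff.2 ⟨l, hb⟩, rfl⟩

theorem Computes.comp {F H : List Bool → ℕ →. ℕ} {G : Set ℕ} {f h : ℕ →. ℕ}
    (hF : Computes F G f) (hH : Computes H G h) :
    Computes (fun σ n => (H σ n).bind (F σ)) G (fun n => h n >>= f) where
  partrec := hH.partrec.bind (hF.partrec.comp (Computable.fst.comp Computable.fst) Computable.snd)
  mono := by
    intro σ τ hστ n v h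
    obtain ⟨a, ha, hv⟩ := Part.mem_bind_iff.1 h
    exact Part.mem_bind_iff.2 ⟨a, hH.mono hστ ha, hF.mono hστ hv⟩
  mem_iff := by
    intro n v
    constructor
    · intro h
      obtain ⟨a, ha, hv⟩ := Part.mem_bind_iff.1 h
      obtain ⟨l, hl⟩ := hH.mem_iff.1 ha
      obtain ⟨m, hm⟩ := hF.mem_iff.1 hv
      exact ⟨max l m, Part.mem_bind_iff.2 ⟨a, hH.mono_initSeg (le_max_left _ _) hl,
        hF.mono_initSeg (le_max_right _ _) hm⟩⟩
    · rintro ⟨l, h⟩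
      obtain ⟨a, ha, hv⟩ := Part.mem_bind_iff.1 h
      exact Part.mem_bind_iff.2 ⟨a, hH.mem_iff.2 ⟨l, ha⟩, hF.mem_iff.2 ⟨l, hv⟩⟩

/-- Primitive recursion over partial functions. -/
def precFun (f h : ℕ →. ℕ) (a n : ℕ) : Part ℕ :=
  Nat.rec (f a) (fun y IH => IH.bind fun i => h (Nat.pair a (Nat.pair y i))) n

theorem mem_precFun_succ {f h : ℕ →. ℕ} {a n v : ℕ} :
    v ∈ precFun f h a (n + 1) ↔
      ∃ i ∈ precFun f h a n, v ∈ h (Nat.pair a (Nat.pair n i)) :=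
  Part.mem_bind_iff

theorem Computes.prec {F H : List Bool → ℕ →. ℕ} {G : Set ℕ} {f h : ℕ →. ℕ}
    (hF : Computes F G f) (hH : Computes H G h) :
    Computes (fun σ p => precFun (F σ) (H σ) p.unpair.1 p.unpair.2) G
      (fun p => precFun f h p.unpair.1 p.unpair.2) := by
  have hmono : ∀ {σ τ : List Bool}, σ <+: τ → ∀ {a n v}, v ∈ precFun (F σ) (H σ) a n →
      v ∈ precFun (F τ) (H τ) a n := by
    intro σ τ hστ a n
    induction n with
    | zero => exact hF.mono hστ
    | succ n ih =>
      intro v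
      simp only [mem_precFun_succ]
      rintro ⟨i, hi, hv⟩
      exact ⟨i, ih hi, hH.mono hστ hv⟩
  refine ⟨?_, fun hστ _ _ => hmono hστ, ?_⟩
  · have hl : Computable fun x : List Bool × ℕ => x.2.unpair.1 :=
      Computable.fst.comp (Computable.unpair.comp Computable.snd)
    refine Partrec.nat_rec
      (h := fun (x : List Bool × ℕ) y => H x.1 (Nat.pair x.2.unpair.1 (Nat.pair y.1 y.2)))
      (Computable.snd.comp (Computable.unpair.comp Computable.snd))
      (hF.partrec.comp Computable.fst hl) ?_
    refine hH.partrec.comp (Computable.fst.comp Computable.fst) ?_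
    exact Primrec₂.natPair.to_comp.comp (hl.comp Computable.fst)
      (Primrec₂.natPair.to_comp.comp (Computable.fst.comp Computable.snd)
        (Computable.snd.comp Computable.snd))
  · intro p v
    generalize p.unpair.1 = a
    generalize p.unpair.2 = n
    induction n generalizing v with
    | zero => exact hF.mem_iff
    | succ n ih =>
      simp only [mem_precFun_succ]
      constructor
      · rintro ⟨i, hi, hv⟩
        obtain ⟨l, hl⟩ := ih.1 hi
        obtain ⟨m, hm⟩ := hH.mem_iff.1 hv
        exact ⟨max l m, i, hmono (initSeg_isPrefix G (le_max_left _ _)) hl,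
          hH.mono_initSeg (le_max_right _ _) hm⟩
      · rintro ⟨l, i, hi, hv⟩
        exact ⟨i, ih.2 ⟨l, hi⟩, hH.mem_iff.2 ⟨l, hv⟩⟩

/-- Finitely many monotone conditions that are eventually true are simultaneously true. -/
theorem exists_forall_lt_of_mono {Q : ℕ → ℕ → Prop}
    (hmono : ∀ {i l m}, l ≤ m → Q i l → Q i m) {n : ℕ} (h : ∀ i < n, ∃ l, Q i l) :
    ∃ l, ∀ i < n, Q i l := by
  choose! l hl using h
  exact ⟨(Finset.range n).sup l, fun i hi =>
    hmono (Finset.le_sup (f := l) (Finset.mem_range.2 hi)) (hl i hi)⟩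

/-- A halting search consults only finitely many values, so by monotonicity one initial segment of
`G` suffices for all of them. -/
theorem Computes.rfind {F : List Bool → ℕ →. ℕ} {G : Set ℕ} {f : ℕ →. ℕ} (hF : Computes F G f) :
    Computes (fun σ a => Nat.rfind fun n => (F σ (Nat.pair a n)).map fun m => decide (m = 0)) G
      (fun a => Nat.rfind fun n => (fun m => decide (m = 0)) <$> f (Nat.pair a n)) := by
  have hmem : ∀ (g : ℕ →. ℕ) (a v : ℕ),
      v ∈ (Nat.rfind fun n => (g (Nat.pair a n)).map fun m => decide (m = 0)) ↔
        0 ∈ g (Nat.pair a v) ∧ ∀ i < v, ∃ m ∈ g (Nat.pair a i), m ≠ 0 := by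
    intro g a v
    refine Nat.mem_rfind.trans ?_
    simp [Part.mem_map_iff]
  refine ⟨?_, ?_, ?_⟩
  · refine Partrec.rfind ?_
    refine (hF.partrec.comp (Computable.fst.comp Computable.fst)
      (Primrec₂.natPair.to_comp.comp (Computable.snd.comp Computable.fst) Computable.snd)).map ?_
    exact (Primrec.eq.decide.to_comp.comp Computable.snd (Computable.const 0))
  · intro σ τ hστ a v
    simp only [hmem]
    rintro ⟨h₀, h⟩
    refine ⟨hF.mono hστ h₀, fun i hi => ?_⟩
    obtain ⟨m, hm, hm0⟩ := h i hi
    exact ⟨m, hF.mono hστ hm, hm0⟩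
  · intro a v
    simp only [Part.map_eq_map, hmem]
    constructor
    · rintro ⟨h₀, h⟩
      obtain ⟨l₀, hl₀⟩ := hF.mem_iff.1 h₀
      obtain ⟨l, hl⟩ := exists_forall_lt_of_mono
        (Q := fun i l => ∃ m ∈ F (initSeg G l) (Nat.pair a i), m ≠ 0)
        (fun hlm ⟨m, hm, hm0⟩ => ⟨m, hF.mono_initSeg hlm hm, hm0⟩) (n := v) fun i hi => by
          obtain ⟨m, hm, hm0⟩ := h i hi
          obtain ⟨l, hl⟩ := hF.mem_iff.1 hm
          exact ⟨l, m, hl, hm0⟩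
      refine ⟨max l₀ l, hF.mono_initSeg (le_max_left _ _) hl₀, fun i hi => ?_⟩
      obtain ⟨m, hm, hm0⟩ := hl i hi
      exact ⟨m, hF.mono_initSeg (le_max_right _ _) hm, hm0⟩
    · rintro ⟨l, h₀, h⟩
      refine ⟨hF.mem_iff.2 ⟨l, h₀⟩, fun i hi => ?_⟩
      obtain ⟨m, hm, hm0⟩ := h i hi
      exact ⟨m, hF.mem_iff.2 ⟨l, hm⟩, hm0⟩

/-- The use principle: a function recursive in `G` is given by a partial recursive functional of
the initial segments of `G`. -/
theorem exists_computes {G : Set ℕ} {f : ℕ →. ℕ} (hf : Nat.RecursiveIn {charFun G} f) :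
    ∃ F, Computes F G f := by
  induction hf with
  | zero => exact ⟨_, .of_partrec .zero G⟩
  | succ => exact ⟨_, .of_partrec .succ G⟩
  | left => exact ⟨_, .of_partrec .left G⟩
  | right => exact ⟨_, .of_partrec .right G⟩
  | oracle g hg => exact (Set.mem_singleton_iff.1 hg) ▸ ⟨_, .oracle G⟩
  | pair _ _ ih₁ ih₂ =>
    obtain ⟨F, hF⟩ := ih₁
    obtain ⟨H, hH⟩ := ih₂
    exact ⟨_, hF.pair hH⟩
  | comp _ _ ih₁ ih₂ =>
    obtain ⟨F, hF⟩ := ih₁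
    obtain ⟨H, hH⟩ := ih₂
    exact ⟨_, hF.comp hH⟩
  | prec _ _ ih₁ ih₂ =>
    obtain ⟨F, hF⟩ := ih₁
    obtain ⟨H, hH⟩ := ih₂
    exact ⟨_, hF.prec hH⟩
  | rfind _ ih =>
    obtain ⟨F, hF⟩ := ih
    exact ⟨_, hF.rfind⟩

/-- If `A` is Turing reducible to `G`, then it is a recursively enumerable relation that the oracle
string `σ` suffices to compute `A` on the length of `ρ`, with outcome `ρ`. -/
theorem SetTuringLE.exists_rePred {A G : Set ℕ} (h : SetTuringLE A G) :
    ∃ P : List Bool → List Bool → Prop, REPred (fun x : List Bool × List Bool => P x.1 x.2) ∧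
      (∀ l ρ, P (initSeg G l) ρ → ρ = initSeg A ρ.length) ∧
      ∀ n, ∃ m, ∀ l ≥ m, P (initSeg G l) (initSeg A n) := by
  classical
  obtain ⟨F, hF⟩ := exists_computes (RecursiveIn.iff_nat.1 h)
  have hval : ∀ i v, v ∈ charFun A i ↔ v = (decide (i ∈ A)).toNat := by
    intro i v
    by_cases hi : i ∈ A <;> simp [charFun, hi]
  -- The default `false` is never reached, since `i < ρ.length`.
  refine ⟨fun σ ρ => ∀ i < ρ.length, ((ρ[i]?).getD false).toNat ∈ F σ i, ?_, ?_, ?_⟩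
  · refine REPred.forall_lt (p := fun (x : List Bool × List Bool) i =>
      ((x.2[i]?).getD false).toNat ∈ F x.1 i) ?_ (Computable.list_length.comp Computable.snd)
    refine (Partrec.rePred_mem hF.partrec).comp (f := fun y : (List Bool × List Bool) × ℕ =>
      ((y.1.1, y.2), ((y.1.2[y.2]?).getD false).toNat)) ?_
    refine ((Computable.fst.comp Computable.fst).pair Computable.snd).pair ?_
    exact (Primrec.dom_bool Bool.toNat).to_comp.comp (Computable.option_getD
      (Computable.list_getElem?.comp (Computable.snd.comp Computable.fst) Computable.snd)
      (Computable.const false))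
  · intro l ρ hρ
    refine eq_initSeg rfl fun i hi => ?_
    have h' := (hval _ _).1 (hF.mem_iff.2 ⟨l, hρ i hi⟩)
    rw [List.getElem?_eq_getElem hi] at h' ⊢
    refine congrArg some ?_
    cases hb : ρ[i] <;> cases hd : decide (i ∈ A) <;> simp [hb, hd] at h' ⊢
  · intro n
    obtain ⟨m, hm⟩ := exists_forall_lt_of_mono
      (Q := fun i l => (((initSeg A n)[i]?).getD false).toNat ∈ F (initSeg G l) i)
      (fun hlm hv => hF.mono_initSeg hlm hv) (n := n) fun i hi => by
        refine hF.mem_iff.1 ((hval _ _).2 ?_)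
        rw [getElem?_initSeg hi]
        rfl
    exact ⟨m, fun l hl i hi => hF.mono_initSeg hl (hm i (by simpa using hi))⟩

/-! ### Limit approximation of Δ⁰₂ sets -/

/-- One direction of the limit lemma: a `Δ⁰₂` set is the pointwise limit of a computable sequence
of sets. -/
theorem IsDelta02.exists_approx {G : Set ℕ} (hG : IsDelta02 G) :
    ∃ g : ℕ → ℕ → Bool, Computable₂ g ∧ ∀ n, ∃ t₀, ∀ t ≥ t₀, (g t n = true ↔ n ∈ G) := by
  classical
  obtain ⟨⟨R, hR, hGR⟩, R', hR', hGR'⟩ := hG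
  have hv : Computable fun y : ((ℕ × ℕ) × ℕ) × ℕ => (y.1.1.2, y.1.2, y.2) :=
    (Computable.snd.comp (Computable.fst.comp Computable.fst)).pair
      ((Computable.snd.comp Computable.fst).pair Computable.snd)
  have hb : Computable fun x : (ℕ × ℕ) × ℕ => x.1.1 := Computable.fst.comp Computable.fst
  have hc₁ : ComputablePred fun x : (ℕ × ℕ) × ℕ => ∀ y < x.1.1, R (x.1.2, x.2, y) :=
    ComputablePred.forall_lt (p := fun (x : (ℕ × ℕ) × ℕ) y => R (x.1.2, x.2, y)) (hR.comp hv) hb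
  have hc₂ : ComputablePred fun x : (ℕ × ℕ) × ℕ => ∀ y < x.1.1, ¬ R' (x.1.2, x.2, y) :=
    ComputablePred.forall_lt (p := fun (x : (ℕ × ℕ) × ℕ) y => ¬ R' (x.1.2, x.2, y))
      (hR'.not.comp hv) hb
  -- At stage `a.1`, look for the least `x` not yet refuted as a Σ⁰₂ witness for membership or for
  -- non-membership; `x = a.1` only makes the search total.
  let P : ℕ × ℕ → ℕ → Prop := fun a x =>
    x = a.1 ∨ (∀ y < a.1, R (a.2, x, y)) ∨ ∀ y < a.1, ¬ R' (a.2, x, y)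
  have hP : ComputablePred fun x : (ℕ × ℕ) × ℕ => P x.1 x.2 :=
    (Computable.snd.computablePred_eq hb).or (hc₁.or hc₂)
  have hex : ∀ a, ∃ x, P a x := fun a => ⟨a.1, Or.inl rfl⟩
  refine ⟨fun t n => decide (∀ y < t, R (n, Nat.find (hex (t, n)), y)), ?_, fun n => ?_⟩
  · exact hc₁.decide.comp (Computable.id.pair (Computable.find hP hex))
  · have htrue : ∃ x, (∀ y, R (n, x, y)) ∨ ∀ y, ¬ R' (n, x, y) := by
      by_cases hn : n ∈ G
      · exact ((hGR n).1 hn).imp fun _ => Or.inl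
      · have := mt (hGR' n).2 hn
        push Not at this
        exact this.imp fun _ => Or.inr
    -- Every smaller `x` is eventually refuted on both sides, so the search settles on `x₀`. If `n ∉
    -- G`, then `x₀` is also refuted as a witness for membership.
    let x₀ := Nat.find htrue
    have hx₀ : (∀ y, R (n, x₀, y)) ∨ ∀ y, ¬ R' (n, x₀, y) := Nat.find_spec htrue
    have hbelow : ∃ l, ∀ x < x₀, (∃ y < l, ¬ R (n, x, y)) ∧ ∃ y < l, R' (n, x, y) := by
      refine exists_forall_lt_of_mono ?_ fun x hx => ?_
      · rintro x l m hlm ⟨⟨y, hy, h⟩, y', hy', h'⟩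
        exact ⟨⟨y, hy.trans_le hlm, h⟩, y', hy'.trans_le hlm, h'⟩
      · have := Nat.find_min htrue hx
        push Not at this
        obtain ⟨⟨y, hy⟩, y', hy'⟩ := this
        exact ⟨max y y' + 1, ⟨y, by omega, hy⟩, y', by omega, hy'⟩
    have hat : ∃ l, n ∉ G → ∃ y < l, ¬ R (n, x₀, y) := by
      by_cases hn : n ∈ G
      · exact ⟨0, fun h => absurd hn h⟩
      · have := mt (hGR n).2 hn
        push Not at this
        obtain ⟨y, hy⟩ := this x₀
        exact ⟨y + 1, fun _ => ⟨y, y.lt_succ_self, hy⟩⟩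
    obtain ⟨l, hl⟩ := hbelow
    obtain ⟨m, hm⟩ := hat
    refine ⟨l + m + x₀ + 1, fun t ht => ?_⟩
    have hfind : Nat.find (hex (t, n)) = x₀ := by
      rw [Nat.find_eq_iff]
      refine ⟨Or.inr (hx₀.imp (fun h y _ => h y) fun h y _ => h y), fun x hx => ?_⟩
      obtain ⟨⟨y, hy, h⟩, y', hy', h'⟩ := hl x hx
      rintro (h₁ | h₁ | h₁)
      · simp only at h₁
        omega
      · exact h (h₁ y (by simp only; omega))
      · exact h₁ y' (by simp only; omega) h'
    beta_reduce
    rw [hfind, decide_eq_true_iff]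
    constructor
    · intro h
      by_contra hn
      obtain ⟨y, hy, h'⟩ := hm hn
      exact h' (h y (by omega))
    · intro hn y _
      refine hx₀.elim (fun h => h y) fun h => ?_
      obtain ⟨y', hy'⟩ := (hGR' n).1 hn x₀
      exact absurd hy' (h y')

/-! ### Density and counting of disagreements -/

open Classical in
/-- The number of arguments below `n` on which `A` and `C` differ. -/
noncomputable def diffCount (A C : Set ℕ) (n : ℕ) : ℕ :=
  ((Finset.range n).filter fun i => ¬ (i ∈ A ↔ i ∈ C)).card

open Classical in
theorem diffCount_mono (A C : Set ℕ) : Monotone (diffCount A C) := fun _ _ hmn =>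
  Finset.card_le_card (Finset.filter_subset_filter _ (Finset.range_subset_range.2 hmn))

/-- At `n = 0` this fails: division by zero makes the left side 0 and the right side 1. -/
theorem densityBelow_agreement (A C : Set ℕ) {n : ℕ} (hn : 0 < n) :
    densityBelow (agreement A C) n = 1 - (diffCount A C n : ℝ) / n := by
  classical
  have h : agreement A C ∩ Set.Iio n = ((Finset.range n).filter fun i => i ∈ A ↔ i ∈ C) := by
    ext i
    simp [agreement, and_comm]
  have hcard : ((Finset.range n).filter fun i => i ∈ A ↔ i ∈ C).card + diffCount A C n = n := by
    simpa [diffCount] using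
      Finset.card_filter_add_card_filter_not (s := Finset.range n) (fun i => i ∈ A ↔ i ∈ C)
  have hcard' : (((Finset.range n).filter fun i => i ∈ A ↔ i ∈ C).card : ℝ)
      = n - diffCount A C n := by
    rw [eq_sub_iff_add_eq]
    exact_mod_cast hcard
  rw [densityBelow, h, Set.ncard_coe_finset, hcard', sub_div, div_self (by positivity)]

theorem hasDensity_agreement_one {A C : Set ℕ}
    (h : ∀ k, ∃ m, ∀ n ≥ m, diffCount A C n * 2 ^ k ≤ n) : HasDensity (agreement A C) 1 := by
  rw [HasDensity, Metric.tendsto_atTop]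
  intro ε hε
  obtain ⟨k, hk⟩ := exists_pow_lt_of_lt_one hε (one_half_lt_one (α := ℝ))
  obtain ⟨m, hm⟩ := h k
  refine ⟨m + 1, fun n hn => ?_⟩
  have hn0 : 0 < n := by omega
  have hn0' : (0 : ℝ) < n := by exact_mod_cast hn0
  have hle : (diffCount A C n : ℝ) * 2 ^ k ≤ n := by exact_mod_cast hm n (by omega)
  rw [densityBelow_agreement A C hn0, Real.dist_eq, sub_sub_cancel_left, abs_neg,
    abs_of_nonneg (by positivity)]
  refine lt_of_le_of_lt ?_ hk
  rw [one_div, inv_pow, div_le_iff₀ hn0', inv_mul_eq_div, le_div_iff₀ (by positivity)]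
  exact hle

theorem densityBelow_nonneg (A : Set ℕ) (n : ℕ) : 0 ≤ densityBelow A n := by
  unfold densityBelow
  positivity

theorem exists_computableSet_diffCount_le {A : Set ℕ} (hA : coarseBound A = 1) (k : ℕ) :
    ∃ C, ComputableSet C ∧ ∃ m, ∀ n ≥ m, diffCount A C n * 2 ^ k ≤ n := by
  have hlt : 1 - (1 / 2 : ℝ) ^ k < coarseBound A := by
    rw [hA]
    have : (0 : ℝ) < (1 / 2 : ℝ) ^ k := by positivity
    linarith
  -- An empty set would have `sSup` equal to 0, not 1.
  have hne : {r : ℝ | r ∈ Set.Icc (0 : ℝ) 1 ∧ CoarselyComputableAt A r}.Nonempty := by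
    by_contra h
    rw [Set.not_nonempty_iff_eq_empty] at h
    rw [coarseBound, h, Real.sSup_empty] at hA
    exact zero_ne_one hA
  obtain ⟨r, ⟨-, C, hC, hr⟩, hkr⟩ := exists_lt_of_lt_csSup hne hlt
  have hev := eventually_lt_of_lt_liminf (hkr.trans_le hr)
    (isBoundedUnder_of ⟨0, fun n => densityBelow_nonneg _ n⟩)
  obtain ⟨m, hm⟩ := eventually_atTop.1 hev
  refine ⟨C, hC, m + 1, fun n hn => ?_⟩
  have hn0 : 0 < n := by omega
  have hn0' : (0 : ℝ) < n := by exact_mod_cast hn0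
  have h := hm n (by omega)
  rw [densityBelow_agreement A C hn0, sub_lt_sub_iff_left, one_div, inv_pow, div_lt_iff₀ hn0',
    inv_mul_eq_div, lt_div_iff₀ (by positivity)] at h
  exact_mod_cast h.le

/-- The number of positions at which two binary strings differ, up to the length of the first. -/
def disagree (ρ μ : List Bool) : ℕ :=
  ((Finset.range ρ.length).filter fun i => ρ[i]? ≠ μ[i]?).card

theorem computable_disagree : Computable₂ disagree := by
  have h : PrimrecRel fun (i : ℕ) (x : List Bool × List Bool) => x.1[i]? ≠ x.2[i]? :=
    (Primrec.eq.comp (Primrec.list_getElem?.comp (Primrec.fst.comp Primrec.snd) Primrec.fst)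
      (Primrec.list_getElem?.comp (Primrec.snd.comp Primrec.snd) Primrec.fst)).not
  exact (Primrec.list_length.comp (h.listFilter.comp
    (Primrec.list_range.comp (Primrec.list_length.comp Primrec.fst)) Primrec.id)).to_comp

/-- The triangle inequality; lengths must match because `disagree` counts only up to the length of
its first argument. -/
theorem disagree_le_add {ρ μ ν : List Bool} (h : ρ.length = ν.length) :
    disagree ρ μ ≤ disagree ρ ν + disagree ν μ := by
  unfold disagree
  rw [← h]
  refine (Finset.card_le_card ?_).trans (Finset.card_union_le _ _)
  intro i
  simp only [Finset.mem_filter, Finset.mem_union]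
  grind

theorem disagree_comm {ρ μ : List Bool} (h : ρ.length = μ.length) :
    disagree ρ μ = disagree μ ρ := by
  unfold disagree
  rw [h]
  simp only [ne_comm]

theorem disagree_initSeg (A C : Set ℕ) (n : ℕ) :
    disagree (initSeg A n) (initSeg C n) = diffCount A C n := by
  classical
  unfold disagree diffCount
  rw [length_initSeg]
  congr 1
  refine Finset.filter_congr fun i hi => ?_
  rw [Finset.mem_range] at hi
  rw [getElem?_initSeg hi, getElem?_initSeg hi]
  simp

/-- Agreement of a string with a computable sequence of sets is decidable. -/
theorem computablePred_agrees {c : ℕ → ℕ → Bool} (hc : Computable₂ c) :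
    ComputablePred fun x : (ℕ × ℕ) × List Bool => ∀ i < x.1.2, x.2[i]? = some (c x.1.1 i) := by
  refine ComputablePred.forall_lt (p := fun (x : (ℕ × ℕ) × List Bool) i =>
    x.2[i]? = some (c x.1.1 i)) ?_ (Computable.snd.comp Computable.fst)
  exact (Computable.list_getElem?.comp (Computable.snd.comp Computable.fst)
    Computable.snd).computablePred_eq (Computable.option_some.comp (hc.comp
      (Computable.fst.comp (Computable.fst.comp Computable.fst)) Computable.snd))

theorem ComputableSet.computablePred_eq_initSeg {C : Set ℕ} (hC : ComputableSet C) :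
    ComputablePred fun μ : List Bool => μ = initSeg C μ.length := by
  classical
  have h := (computablePred_agrees (c := fun _ i => decide (i ∈ C))
    (hC.decide.comp Computable.snd)).comp
    (((Computable.const 0).pair Computable.list_length).pair Computable.id)
  refine h.of_eq fun μ => ⟨fun h => eq_initSeg rfl h, fun h i hi => ?_⟩
  conv_lhs => rw [id, h]
  exact getElem?_initSeg hi

/-! ### Splittings and 1-genericity -/

/-- Two extensions of `σ` compute, via `P`, strings of a common length `n ≥ |σ|` that differ in
more than `n / 2 ^ k` places. -/
def HasSplitting (P : List Bool → List Bool → Prop) (k : ℕ) (σ : List Bool) : Prop :=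
  ∃ w : (List Bool × List Bool) × List Bool × List Bool,
    (P w.1.1 w.1.2 ∧ P w.2.1 w.2.2) ∧ (σ <+: w.1.1 ∧ σ <+: w.2.1) ∧
      w.1.2.length = w.2.2.length ∧ σ.length ≤ w.1.2.length ∧
        w.1.2.length < disagree w.1.2 w.2.2 * 2 ^ k

theorem rePred_hasSplitting {P : List Bool → List Bool → Prop}
    (hP : REPred fun x : List Bool × List Bool => P x.1 x.2) :
    REPred fun x : ℕ × List Bool => HasSplitting P x.1 x.2 := by
  have hσ : Computable fun y : (ℕ × List Bool) × (List Bool × List Bool) × List Bool × List Bool =>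
    y.1.2 := Computable.snd.comp Computable.fst
  have h₁ : Computable fun y : (ℕ × List Bool) ×
    (List Bool × List Bool) × List Bool × List Bool => y.2.1 := Computable.fst.comp Computable.snd
  have h₂ : Computable fun y : (ℕ × List Bool) ×
    (List Bool × List Bool) × List Bool × List Bool => y.2.2 := Computable.snd.comp Computable.snd
  have hl : Computable fun y : (ℕ × List Bool) ×
      (List Bool × List Bool) × List Bool × List Bool => y.2.1.2.length :=
    Computable.list_length.comp (Computable.snd.comp h₁)
  refine REPred.exists (R := fun (x : ℕ × List Bool)
    (w : (List Bool × List Bool) × List Bool × List Bool) => _) ?_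
  refine ((hP.comp h₁).and (hP.comp h₂)).and (ComputablePred.to_re ?_)
  refine ((hσ.computablePred_isPrefix (Computable.fst.comp h₁)).and
    (hσ.computablePred_isPrefix (Computable.fst.comp h₂))).and ?_
  refine (hl.computablePred_eq (Computable.list_length.comp (Computable.snd.comp h₂))).and ?_
  refine ((Computable.list_length.comp hσ).computablePred_le hl).and (hl.computablePred_lt ?_)
  exact Primrec.nat_mul.to_comp.comp
    (computable_disagree.comp (Computable.snd.comp h₁) (Computable.snd.comp h₂))
    (Computable.fst.comp Computable.fst).two_pow

/-- By genericity, the computations from `G` below some initial segment of `G` are as close to each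
other as they are to a computable approximation of the set computed. -/
theorem exists_not_hasSplitting {A G : Set ℕ} {P : List Bool → List Bool → Prop}
    (hG : IsOneGeneric G) (hP : REPred fun x : List Bool × List Bool => P x.1 x.2)
    (hPA : ∀ l ρ, P (initSeg G l) ρ → ρ = initSeg A ρ.length) (hA : coarseBound A = 1) (k : ℕ) :
    ∃ l, ¬ HasSplitting P k (initSeg G l) := by
  -- Half the tolerance: two strings this close to `C` differ in at most a 2^-k fraction of places.
  obtain ⟨C, hC, m, hm⟩ := exists_computableSet_diffCount_le hA (k + 1)
  have hS : REPred fun τ : List Bool => ∃ w : List Bool × List Bool,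
      P τ w.1 ∧ m ≤ w.1.length ∧ (w.2 = initSeg C w.2.length ∧ w.1.length = w.2.length) ∧
        w.1.length < disagree w.1 w.2 * 2 ^ (k + 1) := by
    have h₁ : Computable fun y : List Bool × List Bool × List Bool => y.2.1 :=
      Computable.fst.comp Computable.snd
    have h₂ : Computable fun y : List Bool × List Bool × List Bool => y.2.2 :=
      Computable.snd.comp Computable.snd
    have hl := Computable.list_length.comp h₁
    refine REPred.exists (R := fun (τ : List Bool) (w : List Bool × List Bool) => _) ?_
    refine (hP.comp (Computable.fst.pair h₁)).and (ComputablePred.to_re ?_)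
    refine ((Computable.const m).computablePred_le hl).and (ComputablePred.and
      ((hC.computablePred_eq_initSeg.comp h₂).and
        (hl.computablePred_eq (Computable.list_length.comp h₂))) (hl.computablePred_lt ?_))
    exact Primrec.nat_mul.to_comp.comp (computable_disagree.comp h₁ h₂) (Computable.const _)
  have hav : Avoids G _ := (hG {τ | _} hS).resolve_left ?_
  · obtain ⟨l, hl⟩ := hav
    -- Outputs in a splitting are at least as long as the segment, so length `m` or more puts them
    -- in the range where `C` is a good approximation.
    refine ⟨max l m, ?_⟩
    rintro ⟨⟨⟨τ, ρ⟩, τ', ρ'⟩, ⟨hτ, hτ'⟩, ⟨hσ, hσ'⟩, hlen, hmlen, hlt⟩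
    simp only [length_initSeg] at hτ hτ' hσ hσ' hlen hmlen hlt
    have key : ∀ {τ ρ}, initSeg G (max l m) <+: τ → P τ ρ → m ≤ ρ.length →
        disagree ρ (initSeg C ρ.length) * 2 ^ (k + 1) ≤ ρ.length := by
      intro τ ρ hσ hτ hρ
      by_contra hcon
      refine hl τ ((initSeg_isPrefix G (le_max_left _ _)).trans hσ)
        ⟨(ρ, initSeg C ρ.length), hτ, hρ, ?_, not_le.1 hcon⟩
      simp
    have h₁ := key hσ hτ (by omega)
    have h₂ := key hσ' hτ' (by omega)
    rw [← hlen] at h₂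
    have h₃ := disagree_le_add (ρ := ρ) (μ := ρ') (ν := initSeg C ρ.length) (by simp)
    rw [disagree_comm (ρ := initSeg C ρ.length) (by simpa using hlen)] at h₃
    rw [pow_succ, ← mul_assoc] at h₁ h₂
    have h₄ := Nat.mul_le_mul_right (2 ^ k) h₃
    rw [add_mul] at h₄
    omega
  · rintro ⟨l, ⟨ρ, μ⟩, hρ, hmρ, ⟨hμ, hlen⟩, hlt⟩
    simp only at hρ hmρ hμ hlen hlt
    rw [hμ, hPA l ρ hρ, ← hlen, disagree_initSeg, length_initSeg] at hlt
    exact absurd (hm _ hmρ) (not_le.2 hlt)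

/-! ### Building the coarse description -/

/-- If strings `ρ j` of length `2 ^ (j + 1)` approximate `A` with relative error tending to `0`,
then so does the set that follows `ρ j` on `[2 ^ j, 2 ^ (j + 1))`. -/
theorem hasDensity_of_blocks {A : Set ℕ} {ρ : ℕ → List Bool}
    (hlen : ∀ j, (ρ j).length = 2 ^ (j + 1))
    (h : ∀ k, ∃ j₀, ∀ j ≥ j₀, disagree (ρ j) (initSeg A (2 ^ (j + 1))) * 2 ^ k ≤ 2 ^ (j + 1)) :
    HasDensity (agreement A {n | (ρ (Nat.log 2 n))[n]? = some true}) 1 := by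
  classical
  set C : Set ℕ := {n | (ρ (Nat.log 2 n))[n]? = some true} with hC
  have hstep : ∀ j, diffCount A C (2 ^ (j + 1)) ≤
      diffCount A C (2 ^ j) + disagree (ρ j) (initSeg A (2 ^ (j + 1))) := by
    intro j
    unfold diffCount disagree
    refine (Finset.card_le_card ?_).trans (Finset.card_union_le _ _)
    intro n
    simp only [Finset.mem_filter, Finset.mem_union, Finset.mem_range, hlen]
    rintro ⟨hn, hne⟩
    by_cases hj : n < 2 ^ j
    · exact Or.inl ⟨hj, hne⟩
    · refine Or.inr ⟨hn, fun heq => hne ?_⟩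
      have hlog : Nat.log 2 n = j := Nat.log_eq_of_pow_le_of_lt_pow (not_lt.1 hj) hn
      rw [getElem?_initSeg hn] at heq
      simp [hC, hlog, heq]
  refine hasDensity_agreement_one fun k => ?_
  -- Slack of a factor 8: summing the block errors and rounding `n` up to a power of two cost at
  -- most `4 * n`, and the errors below `2 ^ j₀` at most `n` more.
  obtain ⟨j₀, hj₀⟩ := h (k + 3)
  have hbound : ∀ i, diffCount A C (2 ^ (j₀ + i)) * 2 ^ (k + 3) ≤
      diffCount A C (2 ^ j₀) * 2 ^ (k + 3) + 2 * 2 ^ (j₀ + i) := by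
    intro i
    induction i with
    | zero => simp
    | succ i ih =>
      have h₁ := Nat.mul_le_mul_right (2 ^ (k + 3)) (hstep (j₀ + i))
      have h₂ := hj₀ (j₀ + i) (by omega)
      rw [add_mul] at h₁
      rw [← add_assoc]
      have h₃ : 2 ^ (j₀ + i + 1) = 2 * 2 ^ (j₀ + i) := by ring
      omega
  refine ⟨diffCount A C (2 ^ j₀) * 2 ^ (k + 3) + 2 ^ j₀, fun n hn => ?_⟩
  have hpos : 0 < 2 ^ j₀ := by positivity
  have hn0 : n ≠ 0 := by omega
  have hlog : j₀ ≤ Nat.log 2 n := Nat.le_log_of_pow_le one_lt_two (by omega)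
  obtain ⟨i, hi⟩ := Nat.exists_eq_add_of_le hlog
  have h₁ := hbound (i + 1)
  have h₂ := Nat.mul_le_mul_right (2 ^ (k + 3))
    (diffCount_mono A C (Nat.lt_pow_succ_log_self one_lt_two n).le)
  have h₃ := Nat.pow_log_le_self 2 hn0
  rw [hi] at h₂ h₃
  rw [← add_assoc, pow_succ 2 (j₀ + i)] at h₁
  rw [Nat.succ_eq_add_one, pow_succ 2 (j₀ + i)] at h₂
  simp only [pow_add 2 k 3, ← mul_assoc] at h₁ h₂ hn
  omega

/-- A set computable from a `Δ⁰₂` 1-generic set with coarse computability bound `1` is coarsely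
computable. -/
theorem coarselyComputable_of_le_oneGeneric {G A : Set ℕ} (hΔ : IsDelta02 G)
    (hG : IsOneGeneric G) (hAG : SetTuringLE A G) (hA : coarseBound A = 1) :
    CoarselyComputable A := by
  classical
  obtain ⟨g, hg, hlim⟩ := hΔ.exists_approx
  obtain ⟨P, hP, hPA, hPG⟩ := hAG.exists_rePred
  obtain ⟨B, hB, hPB⟩ := (rePred_hasSplitting hP).exists_computablePred
  have hns := exists_not_hasSplitting hG hP hPA hA
  have hlim' : ∀ l, ∃ t₀, ∀ i < l, ∀ t ≥ t₀, g t i = decide (i ∈ G) := fun l =>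
    exists_forall_lt_of_mono (fun hlm H t ht => H t (le_trans hlm ht)) fun i _ => by
      obtain ⟨t₀, h⟩ := hlim i
      exact ⟨t₀, fun t ht => by rw [Bool.eq_iff_iff, h t ht, decide_eq_true_iff]⟩
  -- `w = (t, τ, ρ)`: relative to the stage `t`, for each `k ≤ j` the string `τ` extends an initial
  -- segment of `G` without splittings, and `τ` computes `ρ`.
  let R : ℕ → (ℕ × List Bool) × List Bool → Prop := fun j w =>
    P w.1.2 w.2 ∧ (j ≤ w.1.1 ∧ w.2.length = 2 ^ (j + 1)) ∧
      ∀ k < j + 1, ∃ l < w.1.2.length + 1,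
        (∀ i < l, w.1.2[i]? = some (g w.1.1 i)) ∧ ∀ c < w.1.1, ¬ B ((k, w.1.2.take l), c)
  have hR : REPred fun x : ℕ × (ℕ × List Bool) × List Bool => R x.1 x.2 := by
    have ht : Computable fun x : ℕ × (ℕ × List Bool) × List Bool => x.2.1.1 :=
      Computable.fst.comp (Computable.fst.comp Computable.snd)
    have hτ : Computable fun x : ℕ × (ℕ × List Bool) × List Bool => x.2.1.2 :=
      Computable.snd.comp (Computable.fst.comp Computable.snd)
    have hρ : Computable fun x : ℕ × (ℕ × List Bool) × List Bool => x.2.2 :=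
      Computable.snd.comp Computable.snd
    have hj : Computable fun x : ℕ × (ℕ × List Bool) × List Bool => x.1 + 1 :=
      Computable.succ.comp Computable.fst
    refine (hP.comp (hτ.pair hρ)).and (ComputablePred.to_re ?_)
    refine ((Computable.fst.computablePred_le ht).and
      ((Computable.list_length.comp hρ).computablePred_eq hj.two_pow)).and ?_
    refine ComputablePred.forall_lt (p := fun (x : ℕ × (ℕ × List Bool) × List Bool) k =>
      ∃ l < x.2.1.2.length + 1, (∀ i < l, x.2.1.2[i]? = some (g x.2.1.1 i)) ∧
        ∀ c < x.2.1.1, ¬ B ((k, x.2.1.2.take l), c)) ?_ hj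
    refine ComputablePred.exists_lt (p := fun (y : (ℕ × (ℕ × List Bool) × List Bool) × ℕ) l =>
      (∀ i < l, y.1.2.1.2[i]? = some (g y.1.2.1.1 i)) ∧
        ∀ c < y.1.2.1.1, ¬ B ((y.2, y.1.2.1.2.take l), c)) ?_
      (Computable.succ.comp (Computable.list_length.comp (hτ.comp Computable.fst)))
    refine ((computablePred_agrees hg).comp (((ht.comp (Computable.fst.comp Computable.fst)).pair
      Computable.snd).pair (hτ.comp (Computable.fst.comp Computable.fst)))).and ?_
    refine ComputablePred.forall_lt
      (p := fun (z : ((ℕ × (ℕ × List Bool) × List Bool) × ℕ) × ℕ) c =>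
        ¬ B ((z.1.2, z.1.1.2.1.2.take z.2), c)) ?_ (ht.comp (Computable.fst.comp Computable.fst))
    refine hB.not.comp (Computable.pair (Computable.pair
      (Computable.snd.comp (Computable.fst.comp Computable.fst)) ?_) Computable.snd)
    exact Primrec.list_take.to_comp.comp (Computable.snd.comp Computable.fst)
      (hτ.comp (Computable.fst.comp (Computable.fst.comp Computable.fst)))
  -- A long enough true segment of `G` qualifies, at a stage where the approximation is correct on
  -- the unsplit segments for all `k ≤ j`.
  have htot : ∀ j, ∃ w, R j w := by
    intro j
    choose l hl using hns
    obtain ⟨m, hm⟩ := hPG (2 ^ (j + 1))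
    let L := (Finset.range (j + 1)).sup l
    have hL : ∀ k < j + 1, l k ≤ L := fun k hk => Finset.le_sup (f := l) (Finset.mem_range.2 hk)
    obtain ⟨t₀, ht₀⟩ := hlim' L
    refine ⟨((max j t₀, initSeg G (max L m)), initSeg A (2 ^ (j + 1))), hm _ (le_max_right _ _),
      ⟨le_max_left _ _, by simp⟩, fun k hk => ⟨l k, ?_, fun i hi => ?_, fun c _ hc => ?_⟩⟩
    · simp only [length_initSeg]
      exact Nat.lt_succ_of_le ((hL k hk).trans (le_max_left _ _))
    · have hiL : i < L := hi.trans_le (hL k hk)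
      simp only
      rw [getElem?_initSeg (hiL.trans_le (le_max_left _ _)), ht₀ i hiL _ (le_max_right _ _)]
    · simp only at hc
      rw [take_initSeg G ((hL k hk).trans (le_max_left _ _))] at hc
      exact hl k ((hPB (k, _)).2 ⟨c, hc⟩)
  have hclose : ∀ k, ∃ j₀, ∀ j ≥ j₀, ∀ w, R j w →
      disagree w.2 (initSeg A (2 ^ (j + 1))) * 2 ^ k ≤ 2 ^ (j + 1) := by
    intro k
    let L := Nat.find (hns k)
    have hL : ¬ HasSplitting P k (initSeg G L) := Nat.find_spec (hns k)
    obtain ⟨b, hb⟩ : ∃ b, ∀ l < L, ∃ c < b, B ((k, initSeg G l), c) := by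
      refine exists_forall_lt_of_mono (fun hlm ⟨c, hc, h⟩ => ⟨c, hc.trans_le hlm, h⟩) fun l hl => ?_
      obtain ⟨c, hc⟩ := (hPB (k, initSeg G l)).1 (not_not.1 (Nat.find_min (hns k) hl))
      exact ⟨c + 1, c, c.lt_succ_self, hc⟩
    obtain ⟨t₀, ht₀⟩ := hlim' L
    -- As `t ≥ j`, the bounds `b` and `t₀` ensure that shorter segments are seen to split and that
    -- `G` is guessed correctly below `L`; `j ≥ k` puts `k` among the tested values, and `j ≥ L`
    -- makes `ρ` long enough for a splitting.
    refine ⟨max (max b t₀) (max k L), fun j hj ⟨⟨t, τ⟩, ρ⟩ ⟨hPτ, ⟨hjt, hρ⟩, H⟩ => ?_⟩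
    simp only at hPτ hjt hρ H ⊢
    obtain ⟨l, hlτ, hag, hnB⟩ := H k (by omega)
    have hseg : ∀ m ≤ L, m ≤ l → τ.take m = initSeg G m := by
      intro m hmL hml
      refine eq_initSeg (by simp; omega) fun i hi => ?_
      rw [List.getElem?_take_of_lt hi, hag i (by omega), ht₀ i (by omega) t (by omega)]
    have hLl : L ≤ l := by
      by_contra hcon
      obtain ⟨c, hc, hBc⟩ := hb l (by omega)
      rw [← hseg l (by omega) le_rfl] at hBc
      exact hnB c (by omega) hBc
    obtain ⟨m, hm⟩ := hPG (2 ^ (j + 1))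
    by_contra hcon
    -- If `ρ` were far from `A`, then `τ` and a true segment of `G` would split the unsplit segment
    -- of length `L`.
    refine hL ⟨((τ, ρ), initSeg G (max L m), initSeg A (2 ^ (j + 1))),
      ⟨hPτ, hm _ (le_max_right _ _)⟩, ⟨?_, initSeg_isPrefix G (le_max_left _ _)⟩, by simp [hρ], ?_, ?_⟩
    · rw [← hseg L le_rfl hLl]
      exact List.take_prefix _ _
    · have : j + 1 < 2 ^ (j + 1) := Nat.lt_two_pow_self
      simp only [length_initSeg, hρ]
      omega
    · simpa [hρ] using hcon
  obtain ⟨f, hf, hfR⟩ := hR.exists_computable_selector htot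
  refine ⟨_, ?_, hasDensity_of_blocks (ρ := fun j => (f j).2) (fun j => (hfR j).2.1.2) fun k => ?_⟩
  · exact (Computable.list_getElem?.comp (Computable.snd.comp (hf.comp Computable.log_two))
      Computable.id).computablePred_eq (Computable.const (some true))
  · obtain ⟨j₀, h⟩ := hclose k
    exact ⟨j₀, fun j hj => h j hj _ (hfR j)⟩

/-! ### A noncomputable Δ⁰₂ 1-generic set -/

theorem isDelta02_of_approx {G : Set ℕ} {g : ℕ → ℕ → Bool} (hg : Computable₂ g)
    (hlim : ∀ n, ∃ t₀, ∀ t ≥ t₀, (g t n = true ↔ n ∈ G)) : IsDelta02 G := by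
  have hn : Computable fun x : ℕ × ℕ × ℕ => x.1 := Computable.fst
  have hx : Computable fun x : ℕ × ℕ × ℕ => x.2.1 := Computable.fst.comp Computable.snd
  have hy : Computable fun x : ℕ × ℕ × ℕ => x.2.2 := Computable.snd.comp Computable.snd
  have hc : ComputablePred fun x : ℕ × ℕ × ℕ => g (x.2.1 + x.2.2) x.1 = true :=
    (hg.comp (Primrec.nat_add.to_comp.comp hx hy) hn).computablePred_eq (Computable.const true)
  refine ⟨⟨_, hc, fun n => ?_⟩, _, hc, fun n => ?_⟩ <;> obtain ⟨t₀, ht₀⟩ := hlim n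
  · refine ⟨fun h => ⟨t₀, fun y => (ht₀ _ (Nat.le_add_right _ _)).2 h⟩, fun ⟨x, h⟩ => ?_⟩
    exact (ht₀ _ (Nat.le_add_left _ _)).1 (h t₀)
  · refine ⟨fun h x => ⟨t₀, (ht₀ _ (Nat.le_add_left _ _)).2 h⟩, fun h => ?_⟩
    obtain ⟨y, hy⟩ := h t₀
    exact (ht₀ _ (Nat.le_add_right _ _)).1 hy

/-- Were `G` computable, the strings off `G` would form a c.e. set; `G` never meets it, yet flipping
one bit after any initial segment enters it. -/
theorem IsOneGeneric.not_computableSet {G : Set ℕ} (hG : IsOneGeneric G) : ¬ ComputableSet G := by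
  classical
  intro hC
  rcases hG {σ | ¬ σ = initSeg G σ.length} hC.computablePred_eq_initSeg.not.to_re with
    ⟨n, hn⟩ | ⟨n, hn⟩
  · simp at hn
  · have h := hn (initSeg G n ++ [! decide (n ∈ G)]) (List.prefix_append _ _)
    rw [Set.mem_ofPred_eq, not_not, List.length_append, length_initSeg,
      List.length_singleton] at h
    have hget := congrArg (fun σ : List Bool => σ[n]?) h
    rw [getElem?_initSeg n.lt_succ_self, List.getElem?_append_right (by simp)] at hget
    simp at hget

/-- There is a computable relation whose sections, projected, are all the recursively enumerable
sets of strings. -/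
theorem exists_universal_rePred :
    ∃ B : (ℕ × List Bool) × ℕ → Prop, ComputablePred B ∧
      ∀ S : Set (List Bool), REPred (fun σ => σ ∈ S) →
        ∃ e, ∀ σ, σ ∈ S ↔ ∃ c, B ((e, σ), c) := by
  have hU : REPred fun x : ℕ × List Bool =>
      (Nat.Partrec.Code.eval (Denumerable.ofNat Nat.Partrec.Code x.1) (Encodable.encode x.2)).Dom :=
    (Nat.Partrec.Code.eval_part.comp ((Computable.ofNat _).comp Computable.fst)
      (Computable.encode.comp Computable.snd)).dom_re
  obtain ⟨B, hB, hUB⟩ := hU.exists_computablePred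
  refine ⟨B, hB, fun S hS => ?_⟩
  obtain ⟨c, hc⟩ := Nat.Partrec.Code.exists_code.1 hS
  refine ⟨Encodable.encode c, fun σ => ?_⟩
  rw [← hUB (Encodable.encode c, σ), Denumerable.ofNat_encode, hc]
  simp [Part.assert, Part.some, Part.bind]

/-- Deciding the `e`-th c.e. condition by a finite extension can be done computably in the limit. -/
theorem exists_limit_extension {B : (ℕ × List Bool) × ℕ → Prop} (hB : ComputablePred B) :
    ∃ next : ℕ × ℕ → List Bool → List Bool, Computable₂ next ∧ ∀ e σ, ∃ τ, σ <+: τ ∧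
      ((∃ c, B ((e, τ), c)) ∨ ∀ τ', σ <+: τ' → ¬ ∃ c, B ((e, τ'), c)) ∧
      ∃ s₀, ∀ s ≥ s₀, next (s, e) σ = τ := by
  classical
  let out : ℕ → List Bool := fun m => (Encodable.decode (α := List Bool) m.unpair.1).getD []
  have hout : Computable out := Computable.option_getD
    (Computable.decode.comp (Computable.fst.comp Computable.unpair)) (Computable.const [])
  let Good : ℕ → List Bool → ℕ → Prop := fun e σ m =>
    σ <+: out m ∧ B ((e, out m), m.unpair.2)
  let P : (ℕ × ℕ) × List Bool → ℕ → Prop := fun a m => m = a.1.1 ∨ Good a.1.2 a.2 m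
  have hs : Computable fun x : ((ℕ × ℕ) × List Bool) × ℕ => x.1.1.1 :=
    Computable.fst.comp (Computable.fst.comp Computable.fst)
  have he : Computable fun x : ((ℕ × ℕ) × List Bool) × ℕ => x.1.1.2 :=
    Computable.snd.comp (Computable.fst.comp Computable.fst)
  have ho : Computable fun x : ((ℕ × ℕ) × List Bool) × ℕ => out x.2 := hout.comp Computable.snd
  have hP : ComputablePred fun x : ((ℕ × ℕ) × List Bool) × ℕ => P x.1 x.2 :=
    (Computable.snd.computablePred_eq hs).or
      (((Computable.snd.comp Computable.fst).computablePred_isPrefix ho).and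
        (hB.comp ((he.pair ho).pair (Computable.snd.comp (Computable.unpair.comp Computable.snd)))))
  have hex : ∀ a, ∃ m, P a m := fun a => ⟨a.1.1, Or.inl rfl⟩
  have hfind : Computable fun a => Nat.find (hex a) := Computable.find hP hex
  -- Until a suitable extension turns up below the stage bound, guess that none exists and keep `σ`;
  -- the guess changes at most once.
  refine ⟨fun p σ => bif decide (Nat.find (hex (p, σ)) < p.1) then out (Nat.find (hex (p, σ)))
    else σ, ?_, fun e σ => ?_⟩
  · exact Computable.cond
      (hfind.computablePred_lt (Computable.fst.comp Computable.fst)).decide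
      (hout.comp hfind) Computable.snd
  · by_cases h : ∃ m, Good e σ m
    · refine ⟨out (Nat.find h), (Nat.find_spec h).1, Or.inl ⟨_, (Nat.find_spec h).2⟩,
        Nat.find h + 1, fun s hs => ?_⟩
      have hfs : Nat.find (hex ((s, e), σ)) = Nat.find h := by
        rw [Nat.find_eq_iff]
        refine ⟨Or.inr (Nat.find_spec h), fun m hm => ?_⟩
        rintro (h' | h')
        · simp only at h'
          omega
        · exact Nat.find_min h hm h'
      beta_reduce
      rw [hfs, decide_eq_true (by omega), cond_true]
    · refine ⟨σ, List.prefix_rfl, Or.inr fun τ hτ ⟨c, hc⟩ => h ⟨Nat.pair (Encodable.encode τ) c, ?_⟩,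
        0, fun s _ => ?_⟩
      · simpa [Good, out] using ⟨hτ, hc⟩
      · beta_reduce
        rw [decide_eq_false, cond_false]
        intro hlt
        rcases Nat.find_spec (hex ((s, e), σ)) with h' | h'
        · exact hlt.ne h'
        · exact h ⟨_, h'⟩

theorem exists_delta02_oneGeneric : ∃ G : Set ℕ, IsDelta02 G ∧ IsOneGeneric G := by
  classical
  obtain ⟨B, hB, huniv⟩ := exists_universal_rePred
  obtain ⟨next, hnext, hlim⟩ := exists_limit_extension hB
  choose lim hpre hdec hlim using hlim
  -- `seq s e` is the stage-`s` guess at `str e`. The extra bit forces `str e` to have length at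
  -- least `e`, so the strings determine all of `G`.
  let seq : ℕ → ℕ → List Bool := fun s e =>
    Nat.rec [] (fun e σ => next (s, e) σ ++ [false]) e
  let str : ℕ → List Bool := fun e => Nat.rec [] (fun e σ => lim e σ ++ [false]) e
  have hseq : Computable₂ seq := by
    refine Computable.nat_rec (h := fun (x : ℕ × ℕ) y => next (x.1, y.1) y.2 ++ [false])
      Computable.snd (Computable.const []) ?_
    exact Computable.list_concat.comp (hnext.comp
      ((Computable.fst.comp Computable.fst).pair (Computable.fst.comp Computable.snd))
      (Computable.snd.comp Computable.snd)) (Computable.const false)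
  have hconv : ∀ e, ∃ s₀, ∀ s ≥ s₀, seq s e = str e := by
    intro e
    induction e with
    | zero => exact ⟨0, fun _ _ => rfl⟩
    | succ e ih =>
      obtain ⟨s₀, hs₀⟩ := ih
      obtain ⟨s₁, hs₁⟩ := hlim e (str e)
      refine ⟨max s₀ s₁, fun s hs => ?_⟩
      change next (s, e) (seq s e) ++ [false] = lim e (str e) ++ [false]
      rw [hs₀ s (le_of_max_le_left hs), hs₁ s (le_of_max_le_right hs)]
  have hstep : ∀ e, lim e (str e) <+: str (e + 1) := fun e => List.prefix_append _ _
  have hchain : ∀ {e e'}, e ≤ e' → str e <+: str e' := by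
    intro e e' h
    induction h with
    | refl => exact List.prefix_rfl
    | step _ ih => exact ih.trans ((hpre _ _).trans (hstep _))
  have hlen : ∀ e, e ≤ (str e).length := by
    intro e
    induction e with
    | zero => exact Nat.zero_le _
    | succ e ih =>
      have h : (str (e + 1)).length = (lim e (str e)).length + 1 := List.length_append
      have := (hpre e (str e)).length_le
      omega
  let G : Set ℕ := {n | (str (n + 1))[n]? = some true}
  have hstr : ∀ e, str e = initSeg G (str e).length := by
    intro e
    refine eq_initSeg rfl fun i hi => ?_
    have hi' : i < (str (i + 1)).length := hlen (i + 1)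
    have heq : (str e)[i]? = (str (i + 1))[i]? := by
      rcases le_total e (i + 1) with h | h
      · obtain ⟨t, ht⟩ := hchain h
        rw [← ht, List.getElem?_append_left hi]
      · obtain ⟨t, ht⟩ := hchain h
        rw [← ht, List.getElem?_append_left hi']
    rw [heq, List.getElem?_eq_getElem hi']
    cases hb : (str (i + 1))[i] <;> simp [G, hb, List.getElem?_eq_getElem hi']
  refine ⟨G, isDelta02_of_approx (g := fun t n => decide ((seq t (n + 1))[n]? = some true)) ?_ ?_,
    fun S hS => ?_⟩
  · exact ((Computable.list_getElem?.comp (hseq.comp Computable.fst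
      (Computable.succ.comp Computable.snd)) Computable.snd).computablePred_eq
        (Computable.const (some true))).decide
  · intro n
    obtain ⟨s₀, hs₀⟩ := hconv (n + 1)
    refine ⟨s₀, fun t ht => ?_⟩
    rw [hs₀ t ht, decide_eq_true_iff]
    rfl
  · obtain ⟨e, he⟩ := huniv S hS
    rcases hdec e (str e) with h | h
    · left
      refine ⟨(lim e (str e)).length, ?_⟩
      have hτ : initSeg G (lim e (str e)).length = lim e (str e) := by
        rw [← take_initSeg G (hstep e).length_le, ← hstr (e + 1)]
        exact (List.prefix_iff_eq_take.1 (hstep e)).symm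
      rw [hτ]
      exact (he _).2 h
    · right
      refine ⟨(str e).length, fun τ hτ hτS => ?_⟩
      rw [← hstr] at hτ
      exact h τ hτ ((he τ).1 hτS)

end CoarseComp

theorem theorem5p11 :
    (∀ G A : Set ℕ, CoarseComp.IsDelta02 G → CoarseComp.IsOneGeneric G →
      CoarseComp.SetTuringLE A G → CoarseComp.coarseBound A = 1 →
        CoarseComp.CoarselyComputable A) ∧
    ¬ ∀ B : Set ℕ, ¬ CoarseComp.ComputableSet B →
      ∃ A : Set ℕ, CoarseComp.SetTuringEquiv A B ∧ CoarseComp.coarseBound A = 1 ∧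
        ¬ CoarseComp.CoarselyComputable A := by
  refine ⟨fun G A hΔ hG hAG hA =>
    CoarseComp.coarselyComputable_of_le_oneGeneric hΔ hG hAG hA, fun H => ?_⟩
  obtain ⟨G, hΔ, hG⟩ := CoarseComp.exists_delta02_oneGeneric
  obtain ⟨A, hAG, hA, hnot⟩ := H G hG.not_computableSet
  exact hnot (CoarseComp.coarselyComputable_of_le_oneGeneric hΔ hG hAG.1 hA)
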